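/- Let $(\mathcal M,\wedge,S)$ be a monoidal model category: a model category with functorial factorizations and a (not necessarily symmetric) closed monoidal structure (both $A\wedge -$ and $-\wedge A$ have right adjoints for every object $A$) such that - for cofibrations $f\colon X\to Y$ and $g\colon U\to V$ the pushout-product $f\Box g\colon X\wedge V\cup_{X\wedge U}Y\wedge U\to Y\wedge V$ is a cofibration, which is trivial if $f$ or $g$ is; - for a cofibrant replacement $q\colon QS\to S$ of the unit and every cofibrant $X$, the maps $q\wedge X$ and $X\wedge q$ are weak equivalences. Assume that $\mathcal M$ is stable, i.e. it has a zero object $\star$ and the suspension functor, which sends $X$ to the homotopy pushout of $\star\leftarrow X\to\star$, is an equivalence $\mathrm{Ho}(\mathcal M)\to\mathrm{Ho}(\mathcal M)$. For a finite poset $C$ let $\mathrm{Ho}(\mathcal M^C)$ be the localization of $\mathcal M^C$ at the vertexwise weak equivalences, and let $I=\{0<1\}$ and $V=\{(1,0)\leftarrow(0,0)\to(0,1)\}$. Let $\operatorname{hocolim}_V\colon \mathrm{Ho}(\mathcal M^V)\to\mathrm{Ho}(\mathcal M)$ be the total left derived functor of $\operatorname{colim}_V$, and define $$\operatorname{cone}\colon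 \mathrm{Ho}(\mathcal M^I)\to\mathrm{Ho}(\mathcal M),\qquad \operatorname{cone}(X\xrightarrow{f}Y)=\operatorname{hocolim}_V\big(\star\leftarrow X\xrightarrow{f}Y\big).$$ Let $\wedge^L\colon \mathrm{Ho}(\mathcal M)\times\mathrm{Ho}(\mathcal M)\to\mathrm{Ho}(\mathcal M)$ and $\Box^L\colon \mathrm{Ho}(\mathcal M^I)\times\mathrm{Ho}(\mathcal M^I)\to\mathrm{Ho}(\mathcal M^I)$ be the total left derived functors of $\wedge$ and $\Box$. Then the derived functors $\operatorname{hocolim}_V$, $\wedge^L$ and $\Box^L$ exist, and there is an isomorphism $$\operatorname{cone}(-)\wedge^L\operatorname{cone}(-)\;\cong\;\operatorname{cone}(-\,\Box^L\,-)$$ of functors $\mathrm{Ho}(\mathcal M^I)\times\mathrm{Ho}(\mathcal M^I)\to\mathrm{Ho}(\mathcal M)$. -/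

import Mathlib

open CategoryTheory CategoryTheory.Limits CategoryTheory.MonoidalCategory HomotopicalAlgebra

universe v u

namespace StableCone

noncomputable section

/-! ### Homotopy categories of a model category and of diagrams in it -/

/-- The homotopy category `Ho(M)`: the localization of `M` at its weak equivalences. -/
abbrev Ho (M : Type u) [Category.{v} M] [ModelCategory M] :=
  (weakEquivalences M).Localization

/-- The localization functor `M ⥤ Ho(M)`. -/
abbrev Ho.Q (M : Type u) [Category.{v} M] [ModelCategory M] : M ⥤ Ho M :=
  (weakEquivalences M).Q

/-- The weak equivalences of arrows: commutative squares whose two components are weak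
equivalences. -/
abbrev arrowW (M : Type u) [Category.{v} M] [ModelCategory M] : MorphismProperty (Arrow M) :=
  (weakEquivalences M).arrow

/-- The homotopy category `Ho(M^{0 < 1})` of arrows of `M`. -/
abbrev HoArrow (M : Type u) [Category.{v} M] [ModelCategory M] :=
  (arrowW M).Localization

/-- The vertexwise weak equivalences of `J`-shaped diagrams. -/
abbrev diagramW (J : Type) [Category.{0} J] (M : Type u) [Category.{v} M] [ModelCategory M] :
    MorphismProperty (J ⥤ M) :=
  (weakEquivalences M).functorCategory J

/-- The homotopy category `Ho(M^J)` of `J`-shaped diagrams in `M`. -/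
abbrev HoDiagram (J : Type) [Category.{0} J] (M : Type u) [Category.{v} M] [ModelCategory M] :=
  (diagramW J M).Localization

/-! ### Homotopy colimits -/

/-- The functor `colim : M^J ⥤ M` has a total left derived functor `Ho(M^J) ⥤ Ho(M)`. -/
abbrev HasHocolim (J : Type) [Category.{0} J] (M : Type u) [Category.{v} M] [ModelCategory M]
    [HasColimitsOfShape J M] : Prop :=
  ((colim : (J ⥤ M) ⥤ M) ⋙ Ho.Q M).HasLeftDerivedFunctor (diagramW J M)

/-- The homotopy colimit `hocolim : Ho(M^J) ⥤ Ho(M)`: the total left derived functor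
of `colim`. -/
def hocolim (J : Type) [Category.{0} J] (M : Type u) [Category.{v} M] [ModelCategory M]
    [HasColimitsOfShape J M] [HasHocolim J M] : HoDiagram J M ⥤ Ho M :=
  ((colim : (J ⥤ M) ⥤ M) ⋙ Ho.Q M).totalLeftDerived (diagramW J M).Q (diagramW J M)

/-! ### The cone -/

open scoped ZeroObject

/-- The strict functor from arrows to spans that sends `f : X ⟶ Y` to the "cokernel diagram"
`0 ⟵ X ⟶ Y`, whose second leg is `f`. -/
def cokernelDiagram (M : Type u) [Category.{v} M] [HasZeroObject M] :
    Arrow M ⥤ (WalkingSpan ⥤ M) where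
  obj f := span ((isZero_zero M).from_ f.left : f.left ⟶ (0 : M)) f.hom
  map φ := spanHomMk φ.left (𝟙 (0 : M)) φ.right
    ((isZero_zero M).eq_of_tgt _ _) φ.w.symm
  map_id f := by
    ext (_ | _ | _)
    · rfl
    · rfl
    · rfl
  map_comp φ ψ := by
    ext (_ | _ | _)
    · rfl
    · exact (isZero_zero M).eq_of_tgt _ _
    · rfl

/-- `cokernelDiagram` preserves weak equivalences. -/
lemma cokernelDiagram_inverts (M : Type u) [Category.{v} M] [ModelCategory M] [HasZeroObject M] :
    (arrowW M).IsInvertedBy (cokernelDiagram M ⋙ (diagramW WalkingSpan M).Q) := by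
  intro f g φ hφ
  refine Localization.inverts (diagramW WalkingSpan M).Q (diagramW WalkingSpan M) _ ?_
  rintro (_ | _ | _)
  · exact hφ.1
  · exact (weakEquivalences M).id_mem (0 : M)
  · exact hφ.2

/-- The functor `Ho(M^{0 < 1}) ⥤ Ho(M^{· ← · → ·})` induced by `cokernelDiagram`. -/
def hoCokernelDiagram (M : Type u) [Category.{v} M] [ModelCategory M] [HasZeroObject M] :
    HoArrow M ⥤ HoDiagram WalkingSpan M :=
  Localization.lift (cokernelDiagram M ⋙ (diagramW WalkingSpan M).Q)
    (cokernelDiagram_inverts M) (arrowW M).Q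

/-- Franke's cone functor `Ho(M^{0 < 1}) ⥤ Ho(M)`: the homotopy colimit of the
cokernel diagram. -/
def cone (M : Type u) [Category.{v} M] [ModelCategory M] [HasZeroObject M]
    [HasHocolim WalkingSpan M] : HoArrow M ⥤ Ho M :=
  hoCokernelDiagram M ⋙ hocolim WalkingSpan M

/-! ### Stability -/

/-- The strict functor that sends an object `X` to the arrow `X ⟶ 0`. -/
def toZero (M : Type u) [Category.{v} M] [HasZeroObject M] : M ⥤ Arrow M where
  obj X := Arrow.mk ((isZero_zero M).from_ X : X ⟶ (0 : M))
  map φ := Arrow.homMk φ (𝟙 (0 : M)) ((isZero_zero M).eq_of_tgt _ _)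
  map_id _ := by ext <;> simp
  map_comp _ _ := by ext <;> simp

/-- `toZero` preserves weak equivalences. -/
lemma toZero_inverts (M : Type u) [Category.{v} M] [ModelCategory M] [HasZeroObject M] :
    (weakEquivalences M).IsInvertedBy (toZero M ⋙ (arrowW M).Q) := by
  intro X Y φ hφ
  exact Localization.inverts (arrowW M).Q (arrowW M) _
    ⟨hφ, (weakEquivalences M).id_mem (0 : M)⟩

/-- The suspension functor `Ho(M) ⥤ Ho(M)`: `Σ X` is the cone of `X ⟶ 0`, that is, the homotopy
pushout of `0 ⟵ X ⟶ 0`. -/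
def suspension (M : Type u) [Category.{v} M] [ModelCategory M] [HasZeroObject M]
    [HasHocolim WalkingSpan M] : Ho M ⥤ Ho M :=
  Localization.lift (toZero M ⋙ (arrowW M).Q) (toZero_inverts M) (Ho.Q M) ⋙ cone M

/-- A pointed model category is stable if the suspension functor on its homotopy category
is an equivalence. (The homotopy pushout functor by which the suspension is defined always exists;
its existence is not part of this assumption.) -/
class IsStable (M : Type u) [Category.{v} M] [ModelCategory M] [HasZeroObject M] : Prop where
  isEquivalence_suspension : ∀ [HasHocolim WalkingSpan M], (suspension M).IsEquivalence

/-! ### Monoidal model categories -/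

/-- The pushout-product of `f : X ⟶ Y` and `g : U ⟶ V`: the canonical map from the pushout of
`X ⊗ V` and `Y ⊗ U` under `X ⊗ U` to `Y ⊗ V`. -/
abbrev pushoutProductHom {M : Type u} [Category.{v} M] [ModelCategory M] [MonoidalCategory M]
    {X Y U V : M} (f : X ⟶ Y) (g : U ⟶ V) :=
  ((MonoidalCategory.Arrow.pushoutProduct.obj (Arrow.mk f)).obj (Arrow.mk g)).hom

/-- A monoidal model category: a model category with functorial factorizations and a closed
monoidal structure that satisfies the pushout-product axiom and the unit axiom.
The monoidal structure need not be symmetric. -/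
class IsMonoidalModelCategory (M : Type u) [Category.{v} M] [ModelCategory M]
    [MonoidalCategory M] : Prop where
  closed_left (X : M) : (tensorLeft X).IsLeftAdjoint
  closed_right (X : M) : (tensorRight X).IsLeftAdjoint
  functorial_factorization₁ :
    (trivialCofibrations M).HasFunctorialFactorization (fibrations M)
  functorial_factorization₂ :
    (cofibrations M).HasFunctorialFactorization (trivialFibrations M)
  cofibration_pushoutProduct {X Y U V : M} (f : X ⟶ Y) (g : U ⟶ V)
    [Cofibration f] [Cofibration g] : Cofibration (pushoutProductHom f g)
  weakEquivalence_pushoutProduct_left {X Y U V : M} (f : X ⟶ Y) (g : U ⟶ V)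
    [Cofibration f] [Cofibration g] [WeakEquivalence f] :
    WeakEquivalence (pushoutProductHom f g)
  weakEquivalence_pushoutProduct_right {X Y U V : M} (f : X ⟶ Y) (g : U ⟶ V)
    [Cofibration f] [Cofibration g] [WeakEquivalence g] :
    WeakEquivalence (pushoutProductHom f g)
  /-- For cofibrant `X` and a cofibrant replacement `q : QS ⟶ 𝟙_ M` of the unit, the map
  `q ⊗ X` is a weak equivalence. -/
  unit_left {QS : M} (q : QS ⟶ 𝟙_ M) [IsCofibrant QS] [Fibration q] [WeakEquivalence q]
    (X : M) [IsCofibrant X] : WeakEquivalence (q ▷ X)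
  /-- For cofibrant `X` and a cofibrant replacement `q : QS ⟶ 𝟙_ M` of the unit, the map
  `X ⊗ q` is a weak equivalence. -/
  unit_right {QS : M} (q : QS ⟶ 𝟙_ M) [IsCofibrant QS] [Fibration q] [WeakEquivalence q]
    (X : M) [IsCofibrant X] : WeakEquivalence (X ◁ q)

/-! ### The derived smash product and the derived pushout-product -/

/-- The monoidal product `M × M ⥤ M` has a total left derived functor
`Ho(M) × Ho(M) ⥤ Ho(M)`. -/
abbrev HasDerivedTensor (M : Type u) [Category.{v} M] [ModelCategory M]
    [MonoidalCategory M] : Prop :=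
  (tensor M ⋙ Ho.Q M).HasLeftDerivedFunctor ((weakEquivalences M).prod (weakEquivalences M))

/-- The derived monoidal product `Ho(M) × Ho(M) ⥤ Ho(M)`. -/
def derivedTensor (M : Type u) [Category.{v} M] [ModelCategory M]
    [MonoidalCategory M] [HasDerivedTensor M] : Ho M × Ho M ⥤ Ho M :=
  (tensor M ⋙ Ho.Q M).totalLeftDerived ((Ho.Q M).prod (Ho.Q M))
    ((weakEquivalences M).prod (weakEquivalences M))

/-- The pushout-product as a functor `M^{0 < 1} × M^{0 < 1} ⥤ M^{0 < 1}`. -/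
abbrev pushoutProduct (M : Type u) [Category.{v} M] [ModelCategory M] [MonoidalCategory M] :
    Arrow M × Arrow M ⥤ Arrow M :=
  Functor.uncurry.obj MonoidalCategory.Arrow.pushoutProduct

/-- Vertexwise weak equivalences of arrows contain the identities. -/
instance (M : Type u) [Category.{v} M] [ModelCategory M] :
    (arrowW M).ContainsIdentities where
  id_mem f := ⟨(weakEquivalences M).id_mem f.left, (weakEquivalences M).id_mem f.right⟩

/-- The pushout-product has a total left derived functor
`Ho(M^{0 < 1}) × Ho(M^{0 < 1}) ⥤ Ho(M^{0 < 1})`. -/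
abbrev HasDerivedPushoutProduct (M : Type u) [Category.{v} M] [ModelCategory M]
    [MonoidalCategory M] : Prop :=
  (pushoutProduct M ⋙ (arrowW M).Q).HasLeftDerivedFunctor ((arrowW M).prod (arrowW M))

/-- The derived pushout-product `Ho(M^{0 < 1}) × Ho(M^{0 < 1}) ⥤ Ho(M^{0 < 1})`. -/
def derivedPushoutProduct (M : Type u) [Category.{v} M] [ModelCategory M]
    [MonoidalCategory M] [HasDerivedPushoutProduct M] : HoArrow M × HoArrow M ⥤ HoArrow M :=
  (pushoutProduct M ⋙ (arrowW M).Q).totalLeftDerived ((arrowW M).Q.prod (arrowW M).Q)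
    ((arrowW M).prod (arrowW M))

end

end StableCone

/-!
On a cofibration `f` between cofibrant objects the cone of `f` is the strict cofiber `Y / X`: the
gluing lemma says that the pushout of a span of cofibrant objects with one leg a cofibration is
already a homotopy pushout. Since `⊗` preserves colimits in each variable, `f □ g` has cofiber
`(Y / X) ⊗ (V / U)`, naturally in `f : X ⟶ Y` and `g : U ⟶ V`. By the pushout-product axiom, `f □ g`
is again a cofibration between cofibrant objects, and `⊗` and `□` preserve weak equivalences
between cofibrant objects and between such cofibrations, respectively (for `□` this is once more
the gluing lemma). So both sides of the asserted isomorphism agree on pairs of such cofibrations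
with the functor `(f, g) ↦ (Y / X) ⊗ (V / U)`. As every arrow is functorially replaced by such a
cofibration, both sides are total left derived functors of this functor, hence isomorphic.
-/

namespace StableCone

section LeftDeformation

universe v₁ v₂ v₃ v₄ u₁ u₂ u₃ u₄

variable {C : Type u₁} {C' : Type u₂} {D : Type u₃} {H : Type u₄} [Category.{v₁} C]
  [Category.{v₂} C'] [Category.{v₃} D] [Category.{v₄} H]

/-- A left deformation of a category with weak equivalences `W`: a functorial replacement of every
object by a weakly equivalent good one. Contrary to a common convention, `good` need not be closed
under isomorphisms, and it is not required that `R` preserve weak equivalences: this is automatic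
when `W` has the two-out-of-three property. -/
structure LeftDeformation (W : MorphismProperty C) where
  /-- the replacement functor -/
  R : C ⥤ C
  /-- the natural weak equivalence from the replacement -/
  ρ : R ⟶ 𝟭 C
  /-- the good objects -/
  good : ObjectProperty C
  good_obj (X : C) : good (R.obj X)
  weq (X : C) : W (ρ.app X)

namespace LeftDeformation

variable {W : MorphismProperty C} {W' : MorphismProperty C'} (d : LeftDeformation W)

lemma map_weq [W.HasTwoOutOfThreeProperty] {X Y : C} (f : X ⟶ Y) (hf : W f) : W (d.R.map f) := by
  refine W.of_postcomp _ (d.ρ.app Y) (d.weq Y) ?_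
  rw [d.ρ.naturality]
  exact W.comp_mem _ _ (d.weq X) hf

/-- A functor is adapted to a left deformation if it inverts the weak equivalences between
good objects. -/
def IsAdapted (F : C ⥤ H) : Prop :=
  ∀ ⦃X Y : C⦄ (f : X ⟶ Y), d.good X → d.good Y → W f → IsIso (F.map f)

/-- The product of two left deformations. -/
def prod (d' : LeftDeformation W') : LeftDeformation (W.prod W') where
  R := d.R.prod d'.R
  ρ := NatTrans.prod d.ρ d'.ρ
  good X := d.good X.1 ∧ d'.good X.2
  good_obj X := ⟨d.good_obj X.1, d'.good_obj X.2⟩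
  weq X := ⟨d.weq X.1, d'.weq X.2⟩

section Comparison

variable {F K N : C ⥤ H} {α : N ⟶ F} (hα : ∀ X, d.good X → IsIso (α.app X))
  (hK : W.IsInvertedBy K)

include hα hK

lemma natTrans_ext {γ₁ γ₂ : K ⟶ N} (h : γ₁ ≫ α = γ₂ ≫ α) : γ₁ = γ₂ := by
  ext X
  have := hα _ (d.good_obj X)
  have hρ : IsIso (K.map (d.ρ.app X)) := hK _ (d.weq X)
  have hR : γ₁.app (d.R.obj X) = γ₂.app (d.R.obj X) :=
    (cancel_mono (α.app (d.R.obj X))).1 (NatTrans.congr_app h _)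
  refine hρ.epi_of_iso.left_cancellation _ _ ?_
  exact (γ₁.naturality _).trans ((congrArg (· ≫ _) hR).trans (γ₂.naturality _).symm)

lemma exists_natTrans_comp_eq (β : K ⟶ F) : ∃ γ : K ⟶ N, γ ≫ α = β := by
  let ρ (G : C ⥤ H) : d.R ⋙ G ⟶ G := Functor.whiskerRight d.ρ G ≫ G.leftUnitor.hom
  have ρ_naturality {G G' : C ⥤ H} (γ : G ⟶ G') : ρ G ≫ γ = Functor.whiskerLeft d.R γ ≫ ρ G' := by
    ext X
    simp [ρ]
  have : IsIso (ρ K) := by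
    have (X : C) : IsIso ((ρ K).app X) := by simpa [ρ] using hK _ (d.weq X)
    exact NatIso.isIso_of_isIso_app _
  have : IsIso (Functor.whiskerLeft d.R α) := by
    have (X : C) : IsIso ((Functor.whiskerLeft d.R α).app X) := hα _ (d.good_obj X)
    exact NatIso.isIso_of_isIso_app _
  refine ⟨inv (ρ K) ≫ Functor.whiskerLeft d.R β ≫ inv (Functor.whiskerLeft d.R α) ≫ ρ N, ?_⟩
  simp only [Category.assoc, ρ_naturality, IsIso.inv_hom_id_assoc, IsIso.inv_comp_eq]

end Comparison

lemma isLeftDerivedFunctor_of_isIso_app {L : C ⥤ D} [L.IsLocalization W] {LF : D ⥤ H}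
    {F : C ⥤ H} (α : L ⋙ LF ⟶ F) (hα : ∀ X, d.good X → IsIso (α.app X)) :
    LF.IsLeftDerivedFunctor α W := by
  have hL (G : D ⥤ H) : W.IsInvertedBy (L ⋙ G) := fun _ _ f hf =>
    have := Localization.inverts L W f hf
    inferInstanceAs (IsIso (G.map (L.map f)))
  choose δ hδ using fun G : D ⥤ H => d.exists_natTrans_comp_eq hα (hL G)
  let lift (G : D ⥤ H) (β : L ⋙ G ⟶ F) : G ⟶ LF :=
    Localization.liftNatTrans L W (L ⋙ G) (L ⋙ LF) G LF (δ G β)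
  have hlift (G : D ⥤ H) (β : L ⋙ G ⟶ F) : Functor.whiskerLeft L (lift G β) ≫ α = β := by
    have : Functor.whiskerLeft L (lift G β) = δ G β := by
      ext X
      simp [lift]
    rw [this, hδ]
  refine ⟨⟨⟨IsTerminal.ofUniqueHom (Y := Functor.RightExtension.mk LF α)
    (fun E => CostructuredArrow.homMk (lift E.left E.hom) (hlift _ _)) fun E m => ?_⟩⟩⟩
  ext1
  refine Localization.natTrans_ext L W fun X => NatTrans.congr_app
    (d.natTrans_ext hα (hL _) (γ₁ := Functor.whiskerLeft L m.left)
      (γ₂ := Functor.whiskerLeft L (lift E.left E.hom)) ?_) X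
  exact (CostructuredArrow.w m).trans (hlift E.left E.hom).symm

variable {d}

lemma IsAdapted.exists_isLeftDerivedFunctor [W.HasTwoOutOfThreeProperty] {F : C ⥤ H}
    (hF : d.IsAdapted F) (L : C ⥤ D) [L.IsLocalization W] :
    ∃ (LF : D ⥤ H) (α : L ⋙ LF ⟶ F),
      LF.IsLeftDerivedFunctor α W ∧ ∀ X, d.good X → IsIso (α.app X) := by
  have hR : W.IsInvertedBy (d.R ⋙ F) := fun _ _ f hf =>
    hF _ (d.good_obj _) (d.good_obj _) (d.map_weq f hf)
  let e : L ⋙ Localization.lift (d.R ⋙ F) hR L ≅ d.R ⋙ F := Localization.fac _ _ _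
  let α : L ⋙ Localization.lift (d.R ⋙ F) hR L ⟶ F :=
    e.hom ≫ Functor.whiskerRight d.ρ F ≫ F.leftUnitor.hom
  have hα (X : C) (hX : d.good X) : IsIso (α.app X) := by
    have := hF _ (d.good_obj X) hX (d.weq X)
    have : α.app X = e.hom.app X ≫ F.map (d.ρ.app X) := by simp [α]
    rw [this]
    infer_instance
  exact ⟨_, α, d.isLeftDerivedFunctor_of_isIso_app α hα, hα⟩

lemma IsAdapted.hasLeftDerivedFunctor [W.HasTwoOutOfThreeProperty] {F : C ⥤ H}
    (hF : d.IsAdapted F) : F.HasLeftDerivedFunctor W := by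
  obtain ⟨LF, α, _, -⟩ := hF.exists_isLeftDerivedFunctor W.Q
  exact Functor.HasLeftDerivedFunctor.mk' LF α

lemma IsAdapted.isIso_counit_app [W.HasTwoOutOfThreeProperty] {F : C ⥤ H} (hF : d.IsAdapted F)
    {L : C ⥤ D} [L.IsLocalization W] {LF : D ⥤ H} (α : L ⋙ LF ⟶ F)
    [LF.IsLeftDerivedFunctor α W] {X : C} (hX : d.good X) : IsIso (α.app X) := by
  obtain ⟨LF', α', _, hα'⟩ := hF.exists_isLeftDerivedFunctor L
  have := hα' X hX
  have fac : (Functor.leftDerivedUnique LF' LF α α' W).hom.app (L.obj X) ≫ α'.app X =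
      α.app X := by simp
  rw [← fac]
  infer_instance

end LeftDeformation

end LeftDeformation

section TwoOutOfThree

variable {C : Type*} [Category* C] {C' : Type*} [Category* C'] (W : MorphismProperty C)
  (W' : MorphismProperty C') [W.HasTwoOutOfThreeProperty] [W'.HasTwoOutOfThreeProperty]

instance functorCategory_hasTwoOutOfThreeProperty (J : Type*) [Category* J] :
    (W.functorCategory J).HasTwoOutOfThreeProperty where
  comp_mem _ _ hf hg j := W.comp_mem _ _ (hf j) (hg j)
  of_postcomp _ _ hg hfg j := W.of_postcomp _ _ (hg j) (hfg j)
  of_precomp _ _ hf hfg j := W.of_precomp _ _ (hf j) (hfg j)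

instance arrow_hasTwoOutOfThreeProperty : W.arrow.HasTwoOutOfThreeProperty where
  comp_mem _ _ hf hg := ⟨W.comp_mem _ _ hf.1 hg.1, W.comp_mem _ _ hf.2 hg.2⟩
  of_postcomp _ _ hg hfg := ⟨W.of_postcomp _ _ hg.1 hfg.1, W.of_postcomp _ _ hg.2 hfg.2⟩
  of_precomp _ _ hf hfg := ⟨W.of_precomp _ _ hf.1 hfg.1, W.of_precomp _ _ hf.2 hfg.2⟩

instance prod_hasTwoOutOfThreeProperty : (W.prod W').HasTwoOutOfThreeProperty where
  comp_mem _ _ hf hg := ⟨W.comp_mem _ _ hf.1 hg.1, W'.comp_mem _ _ hf.2 hg.2⟩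
  of_postcomp _ _ hg hfg := ⟨W.of_postcomp _ _ hg.1 hfg.1, W'.of_postcomp _ _ hg.2 hfg.2⟩
  of_precomp _ _ hf hfg := ⟨W.of_precomp _ _ hf.1 hfg.1, W'.of_precomp _ _ hf.2 hfg.2⟩

end TwoOutOfThree

section Gluing

variable {M : Type u} [Category.{v} M] [ModelCategory M]

lemma weakEquivalence_map_of_isCofibrant {D : Type*} [Category* D] [CategoryWithWeakEquivalences D]
    [(weakEquivalences D).HasTwoOutOfThreeProperty] [(weakEquivalences D).ContainsIdentities]
    (F : M ⥤ D)
    (hF : ∀ ⦃X Y : M⦄ (f : X ⟶ Y) [IsCofibrant X] [IsCofibrant Y] [Cofibration f]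
      [WeakEquivalence f], WeakEquivalence (F.map f))
    {X Y : M} (f : X ⟶ Y) [IsCofibrant X] [IsCofibrant Y] [WeakEquivalence f] :
    WeakEquivalence (F.map f) := by
  obtain ⟨h⟩ := (inferInstance : Nonempty (CofibrantBrownFactorization f))
  have : IsCofibrant h.Z := isCofibrant_of_cofibration h.s
  have := hF h.i
  have := hF h.s
  have : WeakEquivalence (F.map h.s ≫ F.map h.p) := by
    rw [← F.map_comp, h.s_p, F.map_id]
    infer_instance
  have : WeakEquivalence (F.map h.p) := weakEquivalence_of_precomp (F.map h.s) _
  rw [← h.fac, F.map_comp]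
  infer_instance

lemma cofibration_inr_of_isPushout {A A' B P : M} {f : A ⟶ A'} {b : A ⟶ B} {inl : A' ⟶ P}
    {inr : B ⟶ P} (h : IsPushout f b inl inr) [Cofibration f] : Cofibration inr :=
  (cofibration_iff inr).2
    ((cofibrations M).of_isPushout h.flip ((cofibration_iff f).1 inferInstance))

lemma weakEquivalence_inr_of_isPushout {A A' B P : M} {f : A ⟶ A'} {b : A ⟶ B} {inl : A' ⟶ P}
    {inr : B ⟶ P} (h : IsPushout f b inl inr) [Cofibration f] [WeakEquivalence f] :
    WeakEquivalence inr :=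
  ((mem_trivialCofibrations_iff inr).1
    ((trivialCofibrations M).of_isPushout h.flip (mem_trivialCofibrations f))).2

lemma weakEquivalence_of_isPushout_of_trivialCofibration {X A B B' P P' : M} {a : X ⟶ A}
    {b : X ⟶ B} {b' : X ⟶ B'} {inl : A ⟶ P} {inr : B ⟶ P} {inl' : A ⟶ P'} {inr' : B' ⟶ P'}
    (h : IsPushout a b inl inr) (h' : IsPushout a b' inl' inr')
    {w : B ⟶ B'} [Cofibration w] [WeakEquivalence w] (hw : b ≫ w = b')
    {p : P ⟶ P'} (hl : inl ≫ p = inl') (hr : inr ≫ p = w ≫ inr') : WeakEquivalence p := by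
  subst hw hl
  exact weakEquivalence_inr_of_isPushout (h'.of_top hr h).flip

/-- Ken Brown's lemma for the cobase change along `a`, as a functor on the objects under `X`. -/
lemma weakEquivalence_of_isPushout_of_isPushout {X A B B' P P' : M} {a : X ⟶ A} {b : X ⟶ B}
    {b' : X ⟶ B'} {inl : A ⟶ P} {inr : B ⟶ P} {inl' : A ⟶ P'} {inr' : B' ⟶ P'}
    (h : IsPushout a b inl inr) (h' : IsPushout a b' inl' inr') [Cofibration b] [Cofibration b']
    {w : B ⟶ B'} [WeakEquivalence w] (hw : b ≫ w = b') {p : P ⟶ P'} (hl : inl ≫ p = inl')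
    (hr : inr ≫ p = w ≫ inr') : WeakEquivalence p := by
  let φ := MorphismProperty.factorizationData (cofibrations M) (trivialFibrations M)
    (pushout.desc w (𝟙 B') (by simpa using hw) : pushout b b' ⟶ B')
  let i : B ⟶ φ.Z := pushout.inl b b' ≫ φ.i
  let s : B' ⟶ φ.Z := pushout.inr b b' ≫ φ.i
  have i_p : i ≫ φ.p = w := by simp [i, pushout.inl_desc]
  have s_p : s ≫ φ.p = 𝟙 B' := by simp [s, pushout.inr_desc]
  have b_i : b ≫ i = b' ≫ s := by simp [i, s, pushout.condition_assoc]
  have : WeakEquivalence i := weakEquivalence_of_postcomp_of_fac i_p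
  have : WeakEquivalence s := weakEquivalence_of_postcomp_of_fac s_p
  have hZ := IsPushout.of_hasPushout a (b ≫ i)
  let j : P ⟶ pushout a (b ≫ i) := h.desc (pushout.inl _ _) (i ≫ pushout.inr _ _)
    (by simp [hZ.w])
  let t : P' ⟶ pushout a (b ≫ i) := h'.desc (pushout.inl _ _) (s ≫ pushout.inr _ _)
    (by simp [hZ.w, reassoc_of% b_i])
  let q : pushout a (b ≫ i) ⟶ P' := hZ.desc inl' (φ.p ≫ inr')
    (by rw [h'.w, Category.assoc, reassoc_of% i_p, reassoc_of% hw])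
  have : WeakEquivalence j :=
    weakEquivalence_of_isPushout_of_trivialCofibration h hZ rfl (h.inl_desc ..) (h.inr_desc ..)
  have : WeakEquivalence t :=
    weakEquivalence_of_isPushout_of_trivialCofibration h' hZ b_i.symm (h'.inl_desc ..)
      (h'.inr_desc ..)
  have t_q : t ≫ q = 𝟙 P' := h'.hom_ext (by simp [t, q, hZ.inl_desc])
    (by simp [t, q, hZ.inr_desc, reassoc_of% s_p])
  have j_q : j ≫ q = p := h.hom_ext (by simp [j, q, hZ.inl_desc, hl])
    (by simp [j, q, hZ.inr_desc, reassoc_of% i_p, hr])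
  have : WeakEquivalence q := weakEquivalence_of_precomp_of_fac t_q
  rw [← j_q]
  infer_instance

lemma weakEquivalence_inr_of_isPushout_of_section {A A' B P : M} {r : A ⟶ A'} {b : A ⟶ B}
    {inl : A' ⟶ P} {inr : B ⟶ P} (h : IsPushout r b inl inr) [Cofibration b] {s : A' ⟶ A}
    (s_r : s ≫ r = 𝟙 A') [Cofibration s] [WeakEquivalence s] : WeakEquivalence inr := by
  have hs := IsPushout.of_hasPushout s (s ≫ b)
  let w : pushout s (s ≫ b) ⟶ B := hs.desc b (𝟙 B) (by simp)
  let q : pushout s (s ≫ b) ⟶ B := hs.desc (r ≫ s ≫ b) (𝟙 B) (by simp [reassoc_of% s_r])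
  have : WeakEquivalence w := weakEquivalence_of_precomp_of_fac (hs.inr_desc ..)
  have hq : IsPushout r (pushout.inl s (s ≫ b)) (s ≫ b) q := by
    refine IsPushout.of_left (h₁₁ := s) (v₁₁ := s ≫ b) ?_ (hs.inl_desc ..).symm hs
    rw [s_r, hs.inr_desc]
    exact IsPushout.of_horiz_isIso ⟨by simp⟩
  have hsb : (s ≫ b) ≫ inr = inl := by rw [Category.assoc, ← h.w, reassoc_of% s_r]
  refine weakEquivalence_of_isPushout_of_isPushout hq h (w := w) (hs.inl_desc ..) hsb ?_
  refine hs.hom_ext ?_ ?_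
  · simp [q, w, hs.inl_desc_assoc, reassoc_of% s_r, ← h.w]
  · simp [q, w, hs.inr_desc_assoc]

lemma weakEquivalence_inr_of_isPushout_of_isCofibrant {A A' B P : M} {f : A ⟶ A'} {b : A ⟶ B}
    {inl : A' ⟶ P} {inr : B ⟶ P} (h : IsPushout f b inl inr) [IsCofibrant A] [IsCofibrant A']
    [Cofibration b] [WeakEquivalence f] : WeakEquivalence inr := by
  obtain ⟨F⟩ := (inferInstance : Nonempty (CofibrantBrownFactorization f))
  have hi := IsPushout.of_hasPushout F.i b
  let q : pushout F.i b ⟶ P := hi.desc (F.p ≫ inl) inr (by simp [h.w])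
  have hp : IsPushout F.p (pushout.inl F.i b) inl q :=
    IsPushout.of_left (by simpa [q] using h) (hi.inl_desc ..).symm hi
  have : WeakEquivalence q := weakEquivalence_inr_of_isPushout_of_section hp F.s_p
  rw [← (hi.inr_desc .. : pushout.inr F.i b ≫ q = inr)]
  infer_instance

lemma gluing_lemma {X A B P X' A' B' P' : M} {a : X ⟶ A} {b : X ⟶ B}
    {inl : A ⟶ P} {inr : B ⟶ P} {a' : X' ⟶ A'} {b' : X' ⟶ B'} {inl' : A' ⟶ P'} {inr' : B' ⟶ P'}
    (h : IsPushout a b inl inr) (h' : IsPushout a' b' inl' inr')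
    [IsCofibrant A] [IsCofibrant A'] [IsCofibrant X] [IsCofibrant X']
    [Cofibration b] [Cofibration b']
    {fX : X ⟶ X'} {fA : A ⟶ A'} {fB : B ⟶ B'} {p : P ⟶ P'}
    [WeakEquivalence fX] [WeakEquivalence fA] [WeakEquivalence fB]
    (ha : a ≫ fA = fX ≫ a') (hb : b ≫ fB = fX ≫ b')
    (hl : inl ≫ p = fA ≫ inl') (hr : inr ≫ p = fB ≫ inr') : WeakEquivalence p := by
  have hX := IsPushout.of_hasPushout fX b
  have hA := IsPushout.of_hasPushout fA inl
  have : Cofibration inl := cofibration_inr_of_isPushout h.flip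
  have : WeakEquivalence (pushout.inr fX b) := weakEquivalence_inr_of_isPushout_of_isCofibrant hX
  have : WeakEquivalence (pushout.inr fA inl) := weakEquivalence_inr_of_isPushout_of_isCofibrant hA
  let w : pushout fX b ⟶ B' := hX.desc b' fB hb.symm
  have : WeakEquivalence w := weakEquivalence_of_precomp_of_fac (hX.inr_desc ..)
  let c : pushout fX b ⟶ pushout fA inl :=
    hX.desc (a' ≫ pushout.inl fA inl) (inr ≫ pushout.inr fA inl)
      (by rw [← reassoc_of% ha, hA.w, h.w_assoc])
  have hc : IsPushout a' (pushout.inl fX b) (pushout.inl fA inl) c := by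
    refine IsPushout.of_left ?_ (hX.inl_desc ..).symm hX
    rw [← ha, hX.inr_desc]
    exact h.paste_horiz hA
  let q : pushout fA inl ⟶ P' := hA.desc inl' p hl.symm
  have : WeakEquivalence q := by
    refine weakEquivalence_of_isPushout_of_isPushout hc h' (w := w) (hX.inl_desc ..)
      (hA.inl_desc ..) (hX.hom_ext ?_ ?_)
    · simp [c, q, w, hX.inl_desc_assoc, hA.inl_desc, h'.w]
    · simp [c, q, w, hX.inr_desc_assoc, hA.inr_desc, hr]
  rw [← (hA.inr_desc .. : pushout.inr fA inl ≫ q = p)]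
  infer_instance

end Gluing

section FunctorToDiagrams

variable {C D : Type*} [Category* C] [Category* D]

/-- A natural transformation, viewed as a functor to the category of arrows. -/
def arrowOfNatTrans {F G : C ⥤ D} (α : F ⟶ G) : C ⥤ Arrow D where
  obj X := Arrow.mk (α.app X)
  map f := Arrow.homMk (F.map f) (G.map f) (α.naturality f)

/-- The second leg of a span. -/
abbrev spanSnd : (WalkingSpan ⥤ D) ⥤ Arrow D :=
  arrowOfNatTrans ((evaluation WalkingSpan D).map WalkingSpan.Hom.snd)

end FunctorToDiagrams

noncomputable section Replacement

variable {M : Type u} [Category.{v} M] [ModelCategory M]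
  (φ : (cofibrations M).FunctorialFactorizationData (trivialFibrations M))

/-- The functorial cofibrant replacement: factor `⊥_ M ⟶ X`. -/
def cofibrantReplacement : LeftDeformation (weakEquivalences M) where
  R := arrowOfNatTrans (F := (Functor.const M).obj (⊥_ M)) (G := 𝟭 M) { app := initial.to } ⋙ φ.Z
  ρ := Functor.whiskerLeft _ φ.p
  good X := IsCofibrant X
  good_obj X := (isCofibrant_iff_of_isInitial (φ.i.app (Arrow.mk (initial.to X)))
    initialIsInitial).2 ((cofibration_iff _).2 (φ.hi _))
  weq X := (φ.hp _).2

/-- The functor that precomposes an arrow with the cofibrant replacement of its source. -/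
def replaceSource : Arrow M ⥤ Arrow M :=
  arrowOfNatTrans ((Functor.whiskerLeft Arrow.leftFunc (cofibrantReplacement φ).ρ :
    Arrow.leftFunc ⋙ (cofibrantReplacement φ).R ⟶ Arrow.leftFunc) ≫ Arrow.leftToRight)

/-- The functorial replacement of an arrow by a cofibration between cofibrant objects: factor the
composite of the cofibrant replacement of the source with the arrow. -/
def arrowReplacement : LeftDeformation (arrowW M) where
  R := arrowOfNatTrans (Functor.whiskerLeft (replaceSource φ) φ.i)
  ρ.app f := Arrow.homMk ((cofibrantReplacement φ).ρ.app f.left)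
    (φ.p.app ((replaceSource φ).obj f)) (φ.fac_app (f := (replaceSource φ).obj f)).symm
  ρ.naturality f g τ := by
    ext
    · exact (cofibrantReplacement φ).ρ.naturality τ.left
    · exact φ.p.naturality ((replaceSource φ).map τ)
  good f := IsCofibrant f.left ∧ Cofibration f.hom
  good_obj f := ⟨(cofibrantReplacement φ).good_obj f.left, (cofibration_iff _).2 (φ.hi _)⟩
  weq f := ⟨(cofibrantReplacement φ).weq f.left, (φ.hp _).2⟩

/-- The functorial replacement of a span by a span of cofibrant objects whose second leg is a
cofibration: replace the second leg as an arrow and the remaining object as an object. -/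
def spanReplacement : LeftDeformation (diagramW WalkingSpan M) where
  R := (span (Functor.whiskerRight ((evaluation WalkingSpan M).map WalkingSpan.Hom.fst)
    (cofibrantReplacement φ).R) (Functor.whiskerLeft (spanSnd ⋙ replaceSource φ) φ.i)).flip
  ρ.app S := spanHomMk ((cofibrantReplacement φ).ρ.app (S.obj .zero))
    ((cofibrantReplacement φ).ρ.app (S.obj .left)) (φ.p.app ((spanSnd ⋙ replaceSource φ).obj S))
    ((cofibrantReplacement φ).ρ.naturality (S.map WalkingSpan.Hom.fst)) φ.fac_app
  ρ.naturality S S' τ := by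
    ext (_ | _ | _)
    · exact (cofibrantReplacement φ).ρ.naturality (τ.app .zero)
    · exact (cofibrantReplacement φ).ρ.naturality (τ.app .left)
    · exact φ.p.naturality ((spanSnd ⋙ replaceSource φ).map τ)
  good S := IsCofibrant (S.obj .left) ∧ IsCofibrant (S.obj .zero) ∧
    Cofibration (S.map WalkingSpan.Hom.snd)
  good_obj S := ⟨(cofibrantReplacement φ).good_obj _, (cofibrantReplacement φ).good_obj _,
    (cofibration_iff _).2 (φ.hi ((spanSnd ⋙ replaceSource φ).obj S))⟩
  weq S := by
    rintro (_ | _ | _)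
    · exact (cofibrantReplacement φ).weq (S.obj .zero)
    · exact (cofibrantReplacement φ).weq (S.obj .left)
    · exact (φ.hp ((spanSnd ⋙ replaceSource φ).obj S)).2

end Replacement

section Colimit

variable {M : Type u} [Category.{v} M] [ModelCategory M]

lemma isPushout_colimit_ι {C : Type*} [Category* C] (S : WalkingSpan ⥤ C) [HasColimit S] :
    IsPushout (S.map WalkingSpan.Hom.fst) (S.map WalkingSpan.Hom.snd)
      (colimit.ι S .left) (colimit.ι S .right) :=
  .of_isColimit_cocone (colimit.isColimit S)

lemma weakEquivalence_colim_map {S S' : WalkingSpan ⥤ M} (τ : S ⟶ S')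
    [∀ j, WeakEquivalence (τ.app j)] [IsCofibrant (S.obj .left)] [IsCofibrant (S.obj .zero)]
    [Cofibration (S.map WalkingSpan.Hom.snd)]
    [IsCofibrant (S'.obj .left)] [IsCofibrant (S'.obj .zero)]
    [Cofibration (S'.map WalkingSpan.Hom.snd)] : WeakEquivalence (colim.map τ) :=
  gluing_lemma (isPushout_colimit_ι S) (isPushout_colimit_ι S') (τ.naturality _) (τ.naturality _)
    (ι_colimMap τ _) (ι_colimMap τ _)

lemma isAdapted_colim
    (φ : (cofibrations M).FunctorialFactorizationData (trivialFibrations M)) :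
    (spanReplacement φ).IsAdapted ((colim : (WalkingSpan ⥤ M) ⥤ M) ⋙ Ho.Q M) := by
  rintro S S' τ ⟨_, _, _⟩ ⟨_, _, _⟩ hτ
  have (j : WalkingSpan) : WeakEquivalence (τ.app j) := (weakEquivalence_iff _).2 (hτ j)
  exact Localization.inverts (Ho.Q M) (weakEquivalences M) _ (weakEquivalence_colim_map τ).mem

end Colimit

noncomputable section Cofiber

open scoped ZeroObject

lemma preservesZeroMorphisms_of_preservesFiniteColimits {C D : Type*} [Category* C] [Category* D]
    [HasZeroObject C] [HasZeroMorphisms C] [HasZeroMorphisms D] (F : C ⥤ D)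
    [PreservesFiniteColimits F] : F.PreservesZeroMorphisms := by
  have h : IsInitial (F.obj 0) := IsInitial.isInitialObj F _ (isZero_zero C).isInitial
  refine ⟨fun X Y => ?_⟩
  rw [← zero_comp (X := X) (f := (0 : (0 : C) ⟶ Y)), F.map_comp, h.hom_ext (F.map 0) 0, comp_zero]

section PushoutObjObj

variable {C₁ C₂ C : Type*} [Category* C₁] [Category* C₂] [Category* C]
  [HasZeroMorphisms C₁] [HasZeroMorphisms C₂] [HasZeroMorphisms C]
  {X₁ Y₁ : C₁} {f₁ : X₁ ⟶ Y₁} {c₁ : CokernelCofork f₁}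
  {X₂ Y₂ : C₂} {f₂ : X₂ ⟶ Y₂} {c₂ : CokernelCofork f₂}
  {F : C₁ ⥤ C₂ ⥤ C} [(F.obj c₁.pt).PreservesZeroMorphisms] [F.PreservesZeroMorphisms]
  (sq : F.PushoutObjObj f₁ f₂)

/-- Cokernel coforks of `f₁` and `f₂` induce one of their Leibniz pushout under a bifunctor `F`. -/
abbrev leibnizPushoutCofork (c₁ : CokernelCofork f₁) (c₂ : CokernelCofork f₂)
    [(F.obj c₁.pt).PreservesZeroMorphisms] : CokernelCofork sq.ι :=
  CokernelCofork.ofπ ((F.map c₁.π).app Y₂ ≫ (F.obj c₁.pt).map c₂.π) (by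
    refine sq.hom_ext ?_ ?_
    · simp [← Functor.map_comp]
    · simp [← NatTrans.comp_app_assoc, ← Functor.map_comp])

/-- The Leibniz pushout has the same cokernel as the morphism from the coproduct that it
factors. -/
def isColimitLeibnizPushoutCofork (hc₁ : IsColimit c₁) (hc₂ : IsColimit c₂)
    [HasBinaryCoproduct ((F.obj X₁).obj Y₂) ((F.obj Y₁).obj X₂)]
    [PreservesColimit (parallelPair f₂ 0) (F.obj c₁.pt)]
    [PreservesColimit (parallelPair f₁ 0) (F.flip.obj X₂)]
    [PreservesColimit (parallelPair f₁ 0) (F.flip.obj Y₂)] :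
    IsColimit (leibnizPushoutCofork sq c₁ c₂) :=
  isCokernelOfComp (coprod.desc sq.inr sq.inl) _
    (CokernelCofork.isColimitMapBifunctor hc₁ hc₂ F) (leibnizPushoutCofork sq c₁ c₂).condition
    (by ext <;> simp)

end PushoutObjObj

section

variable {C : Type u} [Category.{v} C] [HasZeroObject C]

/-- The strict cofiber of an arrow: the colimit of its cokernel diagram. -/
def cofiber (C : Type u) [Category.{v} C] [HasZeroObject C] [HasPushouts C] : Arrow C ⥤ C :=
  cokernelDiagram C ⋙ colim

variable [HasPushouts C]

/-- The projection from the target of an arrow to its cofiber. -/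
def cofiberπ (f : Arrow C) : f.right ⟶ (cofiber C).obj f :=
  colimit.ι ((cokernelDiagram C).obj f) .right

lemma cofiberπ_naturality {f g : Arrow C} (τ : f ⟶ g) :
    cofiberπ f ≫ (cofiber C).map τ = τ.right ≫ cofiberπ g :=
  ι_colimMap ((cokernelDiagram C).map τ) WalkingSpan.right

lemma isPushout_cofiberπ (f : Arrow C) :
    IsPushout ((isZero_zero C).from_ f.left) f.hom ((isZero_zero C).to_ _) (cofiberπ f) := by
  have h : (isZero_zero C).to_ _ = colimit.ι ((cokernelDiagram C).obj f) .left :=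
    (isZero_zero C).eq_of_src _ _
  exact h ▸ isPushout_colimit_ι ((cokernelDiagram C).obj f)

variable [HasZeroMorphisms C]

/-- The cofiber of an arrow, viewed as a cokernel. -/
abbrev cofiberCofork (f : Arrow C) : CokernelCofork f.hom :=
  CokernelCofork.ofπ (cofiberπ f) (by
    rw [← (isPushout_cofiberπ f).w, (isZero_zero C).eq_zero_of_src ((isZero_zero C).to_ _),
      comp_zero])

def isColimitCofiberCofork (f : Arrow C) : IsColimit (cofiberCofork f) :=
  have h := isPushout_cofiberπ f
  CokernelCofork.IsColimit.ofπ _ _ (fun t ht => h.desc 0 t (by rw [ht, comp_zero]))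
    (fun _ _ => h.inr_desc ..)
    (fun _ _ _ hm => h.hom_ext ((isZero_zero C).eq_of_src _ _) (by rw [hm, h.inr_desc]))

end

section

variable {C : Type u} [Category.{v} C] [HasZeroObject C] [HasFiniteColimits C]
  [MonoidalCategory C] [∀ X : C, PreservesFiniteColimits (tensorLeft X)]
  [∀ X : C, PreservesFiniteColimits (tensorRight X)]

section

variable [HasZeroMorphisms C]

instance preservesZeroMorphisms_tensorLeft (X : C) : (tensorLeft X).PreservesZeroMorphisms :=
  preservesZeroMorphisms_of_preservesFiniteColimits _

instance preservesZeroMorphisms_curriedTensor : (curriedTensor C).PreservesZeroMorphisms where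
  map_zero X Y := by
    ext Z
    have := preservesZeroMorphisms_of_preservesFiniteColimits (tensorRight Z)
    exact (tensorRight Z).map_zero X Y

/-- The cofiber of a pushout-product is the tensor product of the cofibers. -/
def cofiberPushoutProductIso (f g : Arrow C) :
    (cofiber C).obj (f □ g) ≅ (cofiber C).obj f ⊗ (cofiber C).obj g :=
  (isColimitCofiberCofork (f □ g)).coconePointUniqueUpToIso
    (isColimitLeibnizPushoutCofork
      (Functor.PushoutObjObj.ofHasPushout (curriedTensor C) f.hom g.hom)
      (isColimitCofiberCofork f) (isColimitCofiberCofork g))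

lemma cofiberπ_cofiberPushoutProductIso_hom (f g : Arrow C) :
    cofiberπ (f □ g) ≫ (cofiberPushoutProductIso f g).hom = cofiberπ f ⊗ₘ cofiberπ g := by
  rw [MonoidalCategory.tensorHom_def]
  exact IsColimit.comp_coconePointUniqueUpToIso_hom (isColimitCofiberCofork (f □ g)) _
    WalkingParallelPair.one

end

lemma nonempty_cofiberTensorIso :
    Nonempty ((cofiber C).prod (cofiber C) ⋙ tensor C ≅
      Functor.uncurry.obj MonoidalCategory.Arrow.pushoutProduct ⋙ cofiber C) := by
  let _ : HasZeroMorphisms C := HasZeroObject.zeroMorphismsOfZeroObject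
  refine ⟨(NatIso.ofComponents (fun p => cofiberPushoutProductIso p.1 p.2)
    fun {p q} τ => Cofork.IsColimit.hom_ext (isColimitCofiberCofork (p.1 □ p.2)) ?_).symm⟩
  have hτ : ((Functor.uncurry.obj MonoidalCategory.Arrow.pushoutProduct).map τ).right =
      τ.1.right ⊗ₘ τ.2.right := (MonoidalCategory.tensorHom_def _ _).symm
  have hπ : (τ.1.right ⊗ₘ τ.2.right) ≫ (cofiberπ q.1 ⊗ₘ cofiberπ q.2) =
      (cofiberπ p.1 ⊗ₘ cofiberπ p.2) ≫ ((cofiber C).map τ.1 ⊗ₘ (cofiber C).map τ.2) := by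
    simp only [tensorHom_comp_tensorHom, cofiberπ_naturality]
  change cofiberπ (p.1 □ p.2) ≫ (cofiber C).map _ ≫ (cofiberPushoutProductIso q.1 q.2).hom =
    cofiberπ (p.1 □ p.2) ≫ (cofiberPushoutProductIso p.1 p.2).hom ≫
      ((cofiber C).map τ.1 ⊗ₘ (cofiber C).map τ.2)
  rw [reassoc_of% cofiberπ_naturality, cofiberπ_cofiberPushoutProductIso_hom,
    reassoc_of% cofiberπ_cofiberPushoutProductIso_hom]
  exact (congrArg (· ≫ _) hτ).trans hπ

end

end Cofiber

section PushoutProductMap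

variable {C : Type u} [Category.{v} C] [MonoidalCategory C] [HasPushouts C]
  {f f' g g' : Arrow C} (τ : f ⟶ f') (σ : g ⟶ g')

lemma inl_pushoutProduct_map_left :
    pushout.inl (f.hom ▷ g.left) (f.left ◁ g.hom) ≫
        ((MonoidalCategory.Arrow.pushoutProduct.map τ).app g ≫
          (MonoidalCategory.Arrow.pushoutProduct.obj f').map σ).left =
      (τ.right ⊗ₘ σ.left) ≫ pushout.inl (f'.hom ▷ g'.left) (f'.left ◁ g'.hom) := by
  have hτ : pushout.inl (f.hom ▷ g.left) (f.left ◁ g.hom) ≫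
      ((MonoidalCategory.Arrow.pushoutProduct.map τ).app g).left =
        τ.right ▷ g.left ≫ pushout.inl (f'.hom ▷ g.left) (f'.left ◁ g.hom) :=
    IsPushout.inl_desc ..
  have hσ : pushout.inl (f'.hom ▷ g.left) (f'.left ◁ g.hom) ≫
      ((MonoidalCategory.Arrow.pushoutProduct.obj f').map σ).left =
        f'.right ◁ σ.left ≫ pushout.inl (f'.hom ▷ g'.left) (f'.left ◁ g'.hom) :=
    IsPushout.inl_desc ..
  rw [MonoidalCategory.tensorHom_def, Category.assoc]
  exact (Category.assoc ..).symm.trans <| (congrArg (· ≫ _) hτ).trans <|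
    (Category.assoc ..).trans (congrArg (_ ≫ ·) hσ)

lemma inr_pushoutProduct_map_left :
    pushout.inr (f.hom ▷ g.left) (f.left ◁ g.hom) ≫
        ((MonoidalCategory.Arrow.pushoutProduct.map τ).app g ≫
          (MonoidalCategory.Arrow.pushoutProduct.obj f').map σ).left =
      (τ.left ⊗ₘ σ.right) ≫ pushout.inr (f'.hom ▷ g'.left) (f'.left ◁ g'.hom) := by
  have hτ : pushout.inr (f.hom ▷ g.left) (f.left ◁ g.hom) ≫
      ((MonoidalCategory.Arrow.pushoutProduct.map τ).app g).left =
        τ.left ▷ g.right ≫ pushout.inr (f'.hom ▷ g.left) (f'.left ◁ g.hom) :=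
    IsPushout.inr_desc ..
  have hσ : pushout.inr (f'.hom ▷ g.left) (f'.left ◁ g.hom) ≫
      ((MonoidalCategory.Arrow.pushoutProduct.obj f').map σ).left =
        f'.left ◁ σ.right ≫ pushout.inr (f'.hom ▷ g'.left) (f'.left ◁ g'.hom) :=
    IsPushout.inr_desc ..
  rw [MonoidalCategory.tensorHom_def, Category.assoc]
  exact (Category.assoc ..).symm.trans <| (congrArg (· ≫ _) hτ).trans <|
    (Category.assoc ..).trans (congrArg (_ ≫ ·) hσ)

end PushoutProductMap

section PushoutProductAxiom

/-- The pushout-product axiom: the pushout-product of cofibrations is a cofibration, which is a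
weak equivalence if one of the factors is. -/
class PushoutProductAxiom (M : Type u) [Category.{v} M] [ModelCategory M]
    [MonoidalCategory M] : Prop where
  cofibration_pushoutProduct {X Y U V : M} (f : X ⟶ Y) (g : U ⟶ V)
    [Cofibration f] [Cofibration g] : Cofibration (pushoutProductHom f g)
  weakEquivalence_pushoutProduct_left {X Y U V : M} (f : X ⟶ Y) (g : U ⟶ V)
    [Cofibration f] [Cofibration g] [WeakEquivalence f] : WeakEquivalence (pushoutProductHom f g)
  weakEquivalence_pushoutProduct_right {X Y U V : M} (f : X ⟶ Y) (g : U ⟶ V)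
    [Cofibration f] [Cofibration g] [WeakEquivalence g] : WeakEquivalence (pushoutProductHom f g)

variable {M : Type u} [Category.{v} M] [ModelCategory M] [MonoidalCategory M]

section WhiskerLeft

variable [∀ X : M, PreservesFiniteColimits (tensorRight X)]

lemma nonempty_iso_whiskerLeft (X : M) {U V : M} (f : U ⟶ V) :
    Nonempty (Arrow.mk (pushoutProductHom (initial.to X) f) ≅ Arrow.mk (X ◁ f)) :=
  have (Y : M) : PreservesColimitsOfShape (Discrete PEmpty.{1}) ((curriedTensor M).flip.obj Y) :=
    inferInstanceAs (PreservesColimitsOfShape _ (tensorRight Y))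
  ⟨Functor.PushoutObjObj.ι_iso_of_iso_left (F := curriedTensor M)
    (Functor.PushoutObjObj.ofHasPushout _ _ _)
    (Functor.PushoutObjObj.ofIsInitialLeft _ _ _ initialIsInitial)
    (Iso.refl (Arrow.mk (initial.to X)))⟩

variable [PushoutProductAxiom M]

lemma cofibration_whiskerLeft (X : M) [IsCofibrant X] {U V : M} (f : U ⟶ V) [Cofibration f] :
    Cofibration (X ◁ f) := by
  obtain ⟨e⟩ := nonempty_iso_whiskerLeft X f
  have := PushoutProductAxiom.cofibration_pushoutProduct (initial.to X) f
  exact (cofibration_iff _).2 (((cofibrations M).arrow_mk_iso_iff e).1 this.mem)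

lemma weakEquivalence_whiskerLeft (X : M) [IsCofibrant X] {U V : M} (f : U ⟶ V)
    [IsCofibrant U] [IsCofibrant V] [WeakEquivalence f] : WeakEquivalence (X ◁ f) := by
  refine weakEquivalence_map_of_isCofibrant (tensorLeft X) (fun U V f _ _ _ _ => ?_) f
  obtain ⟨e⟩ := nonempty_iso_whiskerLeft X f
  have := PushoutProductAxiom.weakEquivalence_pushoutProduct_right (initial.to X) f
  exact (weakEquivalence_iff _).2 (((weakEquivalences M).arrow_mk_iso_iff e).1 this.mem)

end WhiskerLeft

section WhiskerRight

variable [∀ X : M, PreservesFiniteColimits (tensorLeft X)]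

lemma nonempty_iso_whiskerRight {U V : M} (f : U ⟶ V) (X : M) :
    Nonempty (Arrow.mk (pushoutProductHom f (initial.to X)) ≅ Arrow.mk (f ▷ X)) :=
  have (Y : M) : PreservesColimitsOfShape (Discrete PEmpty.{1}) ((curriedTensor M).obj Y) :=
    inferInstanceAs (PreservesColimitsOfShape _ (tensorLeft Y))
  ⟨Functor.PushoutObjObj.ι_iso_of_iso_left (F := curriedTensor M)
    (Functor.PushoutObjObj.ofHasPushout _ _ _)
    (Functor.PushoutObjObj.ofIsInitialRight _ _ _ initialIsInitial) (Iso.refl (Arrow.mk f))⟩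

variable [PushoutProductAxiom M]

lemma cofibration_whiskerRight {U V : M} (f : U ⟶ V) [Cofibration f] (X : M) [IsCofibrant X] :
    Cofibration (f ▷ X) := by
  obtain ⟨e⟩ := nonempty_iso_whiskerRight f X
  have := PushoutProductAxiom.cofibration_pushoutProduct f (initial.to X)
  exact (cofibration_iff _).2 (((cofibrations M).arrow_mk_iso_iff e).1 this.mem)

lemma weakEquivalence_whiskerRight {U V : M} (f : U ⟶ V) (X : M) [IsCofibrant X]
    [IsCofibrant U] [IsCofibrant V] [WeakEquivalence f] : WeakEquivalence (f ▷ X) := by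
  refine weakEquivalence_map_of_isCofibrant (tensorRight X) (fun U V f _ _ _ _ => ?_) f
  obtain ⟨e⟩ := nonempty_iso_whiskerRight f X
  have := PushoutProductAxiom.weakEquivalence_pushoutProduct_left f (initial.to X)
  exact (weakEquivalence_iff _).2 (((weakEquivalences M).arrow_mk_iso_iff e).1 this.mem)

end WhiskerRight

variable [PushoutProductAxiom M] [∀ X : M, PreservesFiniteColimits (tensorLeft X)]
  [∀ X : M, PreservesFiniteColimits (tensorRight X)]

lemma isCofibrant_tensorObj (X Y : M) [IsCofibrant X] [IsCofibrant Y] : IsCofibrant (X ⊗ Y) :=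
  (isCofibrant_iff_of_isInitial (X ◁ initial.to Y)
    (IsInitial.isInitialObj (tensorLeft X) _ initialIsInitial)).2 (cofibration_whiskerLeft X _)

lemma weakEquivalence_tensorHom {X Y U V : M} (f : X ⟶ Y) (g : U ⟶ V) [IsCofibrant X]
    [IsCofibrant Y] [IsCofibrant U] [IsCofibrant V] [WeakEquivalence f] [WeakEquivalence g] :
    WeakEquivalence (f ⊗ₘ g) := by
  have := weakEquivalence_whiskerRight f U
  have := weakEquivalence_whiskerLeft Y g
  rw [MonoidalCategory.tensorHom_def]
  infer_instance

lemma isCofibrant_pushoutProduct_left (f g : Arrow M) [IsCofibrant f.left] [Cofibration f.hom]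
    [IsCofibrant g.left] [Cofibration g.hom] : IsCofibrant (f □ g).left := by
  have : IsCofibrant g.right := isCofibrant_of_cofibration g.hom
  have := isCofibrant_tensorObj f.left g.right
  have := cofibration_whiskerRight f.hom g.left
  have := cofibration_inr_of_isPushout
    (IsPushout.of_hasPushout (f.hom ▷ g.left) (f.left ◁ g.hom))
  have h : IsCofibrant (pushout (f.hom ▷ g.left) (f.left ◁ g.hom)) :=
    isCofibrant_of_cofibration (pushout.inr _ _)
  exact h

lemma arrowW_pushoutProduct_map {f f' g g' : Arrow M} (τ : f ⟶ f') (σ : g ⟶ g')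
    [IsCofibrant f.left] [Cofibration f.hom] [IsCofibrant f'.left] [Cofibration f'.hom]
    [IsCofibrant g.left] [Cofibration g.hom] [IsCofibrant g'.left] [Cofibration g'.hom]
    (hτ : arrowW M τ) (hσ : arrowW M σ) :
    arrowW M ((pushoutProduct M).map ((τ, σ) : (f, g) ⟶ (f', g'))) := by
  have : IsCofibrant f.right := isCofibrant_of_cofibration f.hom
  have : IsCofibrant f'.right := isCofibrant_of_cofibration f'.hom
  have : IsCofibrant g.right := isCofibrant_of_cofibration g.hom
  have : IsCofibrant g'.right := isCofibrant_of_cofibration g'.hom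
  have : WeakEquivalence τ.left := (weakEquivalence_iff _).2 hτ.1
  have : WeakEquivalence τ.right := (weakEquivalence_iff _).2 hτ.2
  have : WeakEquivalence σ.left := (weakEquivalence_iff _).2 hσ.1
  have : WeakEquivalence σ.right := (weakEquivalence_iff _).2 hσ.2
  have := isCofibrant_tensorObj f.left g.left
  have := isCofibrant_tensorObj f'.left g'.left
  have := isCofibrant_tensorObj f.right g.left
  have := isCofibrant_tensorObj f'.right g'.left
  have := cofibration_whiskerLeft f.left g.hom
  have := cofibration_whiskerLeft f'.left g'.hom
  have := weakEquivalence_tensorHom τ.left σ.left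
  have := weakEquivalence_tensorHom τ.left σ.right
  have := weakEquivalence_tensorHom τ.right σ.left
  have := weakEquivalence_tensorHom τ.right σ.right
  have h : WeakEquivalence ((pushoutProduct M).map ((τ, σ) : (f, g) ⟶ (f', g'))).left :=
    gluing_lemma (IsPushout.of_hasPushout (f.hom ▷ g.left) (f.left ◁ g.hom))
      (IsPushout.of_hasPushout (f'.hom ▷ g'.left) (f'.left ◁ g'.hom))
      (fX := τ.left ⊗ₘ σ.left) (by simp [← tensorHom_id]) (by simp [← id_tensorHom])
      (inl_pushoutProduct_map_left τ σ) (inr_pushoutProduct_map_left τ σ)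
  have h' : WeakEquivalence ((pushoutProduct M).map ((τ, σ) : (f, g) ⟶ (f', g'))).right := by
    have := weakEquivalence_tensorHom τ.right σ.right
    rwa [MonoidalCategory.tensorHom_def] at this
  exact ⟨h.mem, h'.mem⟩

end PushoutProductAxiom

section Comparison

variable {M : Type u} [Category.{v} M] [ModelCategory M]
  (φ : (cofibrations M).FunctorialFactorizationData (trivialFibrations M))

section Cone

variable [HasZeroObject M]

open scoped ZeroObject

lemma isCofibrant_zero : IsCofibrant (0 : M) :=
  have : IsIso (initial.to (0 : M)) :=
    isIso_of_isInitial initialIsInitial (isZero_zero M).isInitial _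
  inferInstance

lemma isCofibrant_cofiber (f : Arrow M) [Cofibration f.hom] : IsCofibrant ((cofiber M).obj f) := by
  have := isCofibrant_zero (M := M)
  have := cofibration_inr_of_isPushout (isPushout_cofiberπ f).flip
  exact isCofibrant_of_cofibration ((isZero_zero M).to_ ((cofiber M).obj f))

/-- The canonical map from the cone, which is a homotopy cofiber, to the strict cofiber. -/
noncomputable def coneToCofiber (M : Type u) [Category.{v} M] [ModelCategory M] [HasZeroObject M]
    [HasHocolim WalkingSpan M] : (arrowW M).Q ⋙ cone M ⟶ cofiber M ⋙ Ho.Q M :=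
  Functor.whiskerRight (Localization.fac (cokernelDiagram M ⋙ (diagramW WalkingSpan M).Q)
      (cokernelDiagram_inverts M) (arrowW M).Q).hom (hocolim WalkingSpan M) ≫
    Functor.whiskerLeft (cokernelDiagram M) (((colim : (WalkingSpan ⥤ M) ⥤ M) ⋙
      Ho.Q M).totalLeftDerivedCounit (diagramW WalkingSpan M).Q (diagramW WalkingSpan M))

include φ in
lemma isIso_coneToCofiber_app [HasHocolim WalkingSpan M] (f : Arrow M) [IsCofibrant f.left]
    [Cofibration f.hom] : IsIso ((coneToCofiber M).app f) := by
  have : IsIso ((((colim : (WalkingSpan ⥤ M) ⥤ M) ⋙ Ho.Q M).totalLeftDerivedCounit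
      (diagramW WalkingSpan M).Q (diagramW WalkingSpan M)).app ((cokernelDiagram M).obj f)) :=
    (isAdapted_colim φ).isIso_counit_app _ ⟨isCofibrant_zero, ‹_›, ‹_›⟩
  exact IsIso.comp_isIso' (inferInstanceAs (IsIso ((hocolim WalkingSpan M).map _))) this

end Cone

variable [MonoidalCategory M] [PushoutProductAxiom M]
  [∀ X : M, PreservesFiniteColimits (tensorLeft X)]
  [∀ X : M, PreservesFiniteColimits (tensorRight X)]

lemma isAdapted_tensor :
    ((cofibrantReplacement φ).prod (cofibrantReplacement φ)).IsAdapted (tensor M ⋙ Ho.Q M) := by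
  rintro ⟨X, U⟩ ⟨Y, V⟩ ⟨f, g⟩ ⟨hX, hU⟩ ⟨hY, hV⟩ ⟨hf, hg⟩
  have : IsCofibrant X := hX
  have : IsCofibrant U := hU
  have : IsCofibrant Y := hY
  have : IsCofibrant V := hV
  have : WeakEquivalence f := (weakEquivalence_iff _).2 hf
  have : WeakEquivalence g := (weakEquivalence_iff _).2 hg
  exact Localization.inverts (Ho.Q M) (weakEquivalences M) _ (weakEquivalence_tensorHom f g).mem

lemma isAdapted_pushoutProduct :
    ((arrowReplacement φ).prod (arrowReplacement φ)).IsAdapted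
      (pushoutProduct M ⋙ (arrowW M).Q) := by
  rintro ⟨f, g⟩ ⟨f', g'⟩ ⟨τ, σ⟩ ⟨⟨_, _⟩, _, _⟩ ⟨⟨_, _⟩, _, _⟩ ⟨hτ, hσ⟩
  exact Localization.inverts (arrowW M).Q (arrowW M) _ (arrowW_pushoutProduct_map τ σ hτ hσ)

variable [HasZeroObject M] [HasHocolim WalkingSpan M]

include φ in
lemma exists_isLeftDerivedFunctor_cone_tensor [HasDerivedTensor M] :
    ∃ α : (arrowW M).Q.prod (arrowW M).Q ⋙ (cone M).prod (cone M) ⋙ derivedTensor M ⟶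
        ((cofiber M).prod (cofiber M) ⋙ tensor M) ⋙ Ho.Q M,
      ((cone M).prod (cone M) ⋙ derivedTensor M).IsLeftDerivedFunctor α
        ((arrowW M).prod (arrowW M)) := by
  let θ := coneToCofiber M
  let η := (tensor M ⋙ Ho.Q M).totalLeftDerivedCounit ((Ho.Q M).prod (Ho.Q M))
    ((weakEquivalences M).prod (weakEquivalences M))
  refine ⟨Functor.whiskerRight (NatTrans.prod θ θ) (derivedTensor M) ≫
      Functor.whiskerLeft ((cofiber M).prod (cofiber M)) η,
    ((arrowReplacement φ).prod (arrowReplacement φ)).isLeftDerivedFunctor_of_isIso_app _ ?_⟩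
  rintro ⟨f, g⟩ ⟨⟨_, _⟩, _, _⟩
  have hθ : IsIso ((NatTrans.prod θ θ).app (f, g)) :=
    (isIso_prod_iff _ _).2 ⟨isIso_coneToCofiber_app φ f, isIso_coneToCofiber_app φ g⟩
  have hη : IsIso (η.app ((cofiber M).obj f, (cofiber M).obj g)) :=
    (isAdapted_tensor φ).isIso_counit_app _ ⟨isCofibrant_cofiber f, isCofibrant_cofiber g⟩
  exact IsIso.comp_isIso' (inferInstanceAs (IsIso ((derivedTensor M).map _))) hη

include φ in
lemma exists_isLeftDerivedFunctor_pushoutProduct_cone [HasDerivedPushoutProduct M] :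
    ∃ α : (arrowW M).Q.prod (arrowW M).Q ⋙ derivedPushoutProduct M ⋙ cone M ⟶
        (pushoutProduct M ⋙ cofiber M) ⋙ Ho.Q M,
      (derivedPushoutProduct M ⋙ cone M).IsLeftDerivedFunctor α
        ((arrowW M).prod (arrowW M)) := by
  let θ := coneToCofiber M
  let η := (pushoutProduct M ⋙ (arrowW M).Q).totalLeftDerivedCounit
    ((arrowW M).Q.prod (arrowW M).Q) ((arrowW M).prod (arrowW M))
  refine ⟨Functor.whiskerRight η (cone M) ≫ Functor.whiskerLeft (pushoutProduct M) θ,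
    ((arrowReplacement φ).prod (arrowReplacement φ)).isLeftDerivedFunctor_of_isIso_app _ ?_⟩
  rintro ⟨f, g⟩ hfg
  have hη : IsIso (η.app (f, g)) := (isAdapted_pushoutProduct φ).isIso_counit_app _ hfg
  obtain ⟨⟨_, _⟩, _, _⟩ := hfg
  have := isCofibrant_pushoutProduct_left f g
  have : Cofibration (f □ g).hom := PushoutProductAxiom.cofibration_pushoutProduct f.hom g.hom
  have hθ : IsIso (θ.app (f □ g)) := isIso_coneToCofiber_app φ (f □ g)
  exact IsIso.comp_isIso' (inferInstanceAs (IsIso ((cone M).map (η.app (f, g))))) hθ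

include φ in
lemma nonempty_coneTensorIso [HasDerivedTensor M] [HasDerivedPushoutProduct M] :
    Nonempty ((cone M).prod (cone M) ⋙ derivedTensor M ≅ derivedPushoutProduct M ⋙ cone M) := by
  obtain ⟨e⟩ := nonempty_cofiberTensorIso (C := M)
  obtain ⟨α, _⟩ := exists_isLeftDerivedFunctor_cone_tensor φ
  obtain ⟨β, _⟩ := exists_isLeftDerivedFunctor_pushoutProduct_cone φ
  exact ⟨Functor.leftDerivedNatIso _ _ α β ((arrowW M).prod (arrowW M))
    (Functor.isoWhiskerRight e (Ho.Q M))⟩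

end Comparison

section IsMonoidalModelCategory

variable {M : Type u} [Category.{v} M] [ModelCategory M] [MonoidalCategory M]
  [IsMonoidalModelCategory M]

instance : PushoutProductAxiom M where
  cofibration_pushoutProduct := IsMonoidalModelCategory.cofibration_pushoutProduct
  weakEquivalence_pushoutProduct_left :=
    IsMonoidalModelCategory.weakEquivalence_pushoutProduct_left
  weakEquivalence_pushoutProduct_right :=
    IsMonoidalModelCategory.weakEquivalence_pushoutProduct_right

instance (X : M) : (tensorLeft X).IsLeftAdjoint := IsMonoidalModelCategory.closed_left X

instance (X : M) : (tensorRight X).IsLeftAdjoint := IsMonoidalModelCategory.closed_right X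

end IsMonoidalModelCategory

end StableCone

theorem mainTheorem4_general (M : Type u) [Category.{v} M] [ModelCategory M] [HasZeroObject M]
    [MonoidalCategory M] [∀ X : M, PreservesFiniteColimits (tensorLeft X)]
    [∀ X : M, PreservesFiniteColimits (tensorRight X)] [StableCone.PushoutProductAxiom M]
    [(cofibrations M).HasFunctorialFactorization (trivialFibrations M)] :
    ∃ (_ : StableCone.HasHocolim WalkingSpan M) (_ : StableCone.HasDerivedTensor M)
      (_ : StableCone.HasDerivedPushoutProduct M),
      Nonempty ((StableCone.cone M).prod (StableCone.cone M) ⋙ StableCone.derivedTensor M ≅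
        StableCone.derivedPushoutProduct M ⋙ StableCone.cone M) := by
  let φ := MorphismProperty.functorialFactorizationData (cofibrations M) (trivialFibrations M)
  have h₁ : StableCone.HasHocolim WalkingSpan M :=
    (StableCone.isAdapted_colim φ).hasLeftDerivedFunctor
  have h₂ : StableCone.HasDerivedTensor M := (StableCone.isAdapted_tensor φ).hasLeftDerivedFunctor
  have h₃ : StableCone.HasDerivedPushoutProduct M :=
    (StableCone.isAdapted_pushoutProduct φ).hasLeftDerivedFunctor
  exact ⟨h₁, h₂, h₃, StableCone.nonempty_coneTensorIso φ⟩

/-- In a stable monoidal model category `M`, the homotopy pushout functor (hence the cone), the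
derived smash product and the derived pushout-product exist, and there is an isomorphism
`cone(f) ∧ᴸ cone(g) ≅ cone(f □ᴸ g)`, natural in `f` and `g` in `Ho(M^{0 < 1})`. -/
theorem mainTheorem4 (M : Type u) [Category.{v} M] [ModelCategory M] [HasZeroObject M]
    [MonoidalCategory M] [StableCone.IsMonoidalModelCategory M] [StableCone.IsStable M] :
    ∃ (_ : StableCone.HasHocolim WalkingSpan M) (_ : StableCone.HasDerivedTensor M)
      (_ : StableCone.HasDerivedPushoutProduct M),
      Nonempty ((StableCone.cone M).prod (StableCone.cone M) ⋙ StableCone.derivedTensor M ≅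
        StableCone.derivedPushoutProduct M ⋙ StableCone.cone M) :=
  have := StableCone.IsMonoidalModelCategory.functorial_factorization₂ (M := M)
  mainTheorem4_general M
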